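/- Let $d\ge 1$, and let $\mathcal N(m,\Sigma)$ denote the Gaussian distribution on a Euclidean space with mean $m$ and positive semidefinite covariance $\Sigma$ (possibly singular). A finite Gaussian mixture is a finite convex combination of Gaussian distributions. For probability measures $\mu,\nu$ on $\mathbb R^d$ let $\Pi(\mu,\nu)$ be the set of probability measures on $\mathbb R^d\times\mathbb R^d$ with marginals $\mu$ and $\nu$, and put $$W_2^2(\mu,\nu)=\inf_{\gamma\in\Pi(\mu,\nu)}\int\|x-y\|^2\,d\gamma(x,y),\qquad MW_2^2(\mu,\nu)=\inf_{\gamma}\int\|x-y\|^2\,d\gamma(x,y),$$ where the second infimum is over those $\gamma\in\Pi(\mu,\nu)$ that are finite Gaussian mixtures on $\mathbb R^d\times\mathbb R^d=\mathbb R^{2d}$. A minimizer of the first (second) problem is called an optimal plan for $W_2$ (for $MW_2$). A $W_2$-optimal map from $\mu$ to $\nu$ is a measurable $T:\mathbb R^d\to\mathbb R^d$ such that $(\mathrm{Id},T)\#\mu$ is an optimal plan for $W_2$ between $\mu$ and $\nu$. Let $\mu_0=\sum_{k=1}^{K_0}\pi_0^k\mu_0^k$ and $\mu_1=\sum_{l=1}^{K_1}\pi_1^l\mu_1^l$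 with $\mu_i^k=\mathcal N(m_i^k,\Sigma_i^k)$, $\pi_i^k\ge 0$ and $\sum_k\pi_i^k=1$ for $i=0,1$. Let $\Pi(\pi_0,\pi_1)$ be the set of $K_0\times K_1$ matrices $w$ with nonnegative entries such that $\sum_l w_{kl}=\pi_0^k$ for all $k$ and $\sum_k w_{kl}=\pi_1^l$ for all $l$. Then $MW_2^2(\mu_0,\mu_1)$ is finite and $$MW_2^2(\mu_0,\mu_1)=\min_{w\in\Pi(\pi_0,\pi_1)}\sum_{k,l}w_{kl}\,W_2^2(\mu_0^k,\mu_1^l),$$ the minimum being attained. For all $k,l$ there is an optimal plan for $W_2$ between $\mu_0^k$ and $\mu_1^l$ that is a Gaussian distribution on $\mathbb R^{2d}$; and if $\Sigma_0^k$ is nonsingular, there is a $W_2$-optimal map from $\mu_0^k$ to $\mu_1^l$, unique up to $\mu_0^k$-null sets. Moreover, let $w^*$ be any minimizer of the discrete problem. (i) If, for all $k,l$, $\gamma_{kl}$ is a Gaussian optimal plan for $W_2$ between $\mu_0^k$ and $\mu_1^l$, then $\gamma^*=\sum_{k,l}w^*_{kl}\gamma_{kl}$ is an optimal plan for $MW_2$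 between $\mu_0$ and $\mu_1$ (in particular it is a finite Gaussian mixture in $\Pi(\mu_0,\mu_1)$). (ii) If all $\Sigma_0^k$ are nonsingular and, for all $k,l$, $T_{kl}$ is a $W_2$-optimal map from $\mu_0^k$ to $\mu_1^l$, then $\gamma^*=\sum_{k,l}w^*_{kl}\,(\mathrm{Id},T_{kl})\#\mu_0^k$ is an optimal plan for $MW_2$ between $\mu_0$ and $\mu_1$. -/

import Mathlib

open MeasureTheory ProbabilityTheory
open scoped NNReal ENNReal

namespace GMMTransport

/-- Finite Gaussian mixtures on `E`: finite convex combinations of Gaussian measures, where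
degenerate (singular covariance) Gaussian measures are allowed. -/
def IsGaussianMixture {E : Type*} [TopologicalSpace E] [AddCommMonoid E] [Module ℝ E]
    [MeasurableSpace E] (μ : Measure E) : Prop :=
  ∃ (K : ℕ) (p : Fin K → ℝ≥0) (ν : Fin K → Measure E),
    ∑ k, p k = 1 ∧ (∀ k, IsGaussian (ν k)) ∧ μ = ∑ k, p k • ν k

/-- `ℝ^d` with the Euclidean norm. -/
abbrev Euc (d : ℕ) : Type := EuclideanSpace ℝ (Fin d)

/-- The set `Π(μ, ν)` of probability measures on `ℝ^d × ℝ^d` with marginals `μ` and `ν`. -/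
def couplings {d : ℕ} (μ ν : Measure (Euc d)) : Set (Measure (Euc d × Euc d)) :=
  {γ | IsProbabilityMeasure γ ∧ γ.map Prod.fst = μ ∧ γ.map Prod.snd = ν}

/-- The elements of `Π(μ, ν)` that are finite Gaussian mixtures on `ℝ^d × ℝ^d = ℝ^{2d}`. -/
def gmmCouplings {d : ℕ} (μ ν : Measure (Euc d)) : Set (Measure (Euc d × Euc d)) :=
  couplings μ ν ∩ {γ | IsGaussianMixture γ}

/-- The quadratic transport cost `∫ ‖x - y‖² dγ(x, y)`, with values in `[0, ∞]`. -/
noncomputable def cost {d : ℕ} (γ : Measure (Euc d × Euc d)) : ℝ≥0∞ :=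
  ∫⁻ z, ‖z.1 - z.2‖ₑ ^ 2 ∂γ

/-- The squared Wasserstein distance `W₂²`. -/
noncomputable def W2sq {d : ℕ} (μ ν : Measure (Euc d)) : ℝ≥0∞ :=
  ⨅ γ ∈ couplings μ ν, cost γ

/-- `MW₂²`: the optimal transport cost restricted to Gaussian mixture couplings. -/
noncomputable def MW2sq {d : ℕ} (μ ν : Measure (Euc d)) : ℝ≥0∞ :=
  ⨅ γ ∈ gmmCouplings μ ν, cost γ

/-- `γ` is an optimal transport plan for `W₂` between `μ` and `ν`. -/
def IsW2OptimalPlan {d : ℕ} (μ ν : Measure (Euc d)) (γ : Measure (Euc d × Euc d)) : Prop :=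
  γ ∈ couplings μ ν ∧ IsMinOn cost (couplings μ ν) γ

/-- `γ` is an optimal transport plan for `MW₂` between `μ` and `ν`. -/
def IsMW2OptimalPlan {d : ℕ} (μ ν : Measure (Euc d)) (γ : Measure (Euc d × Euc d)) : Prop :=
  γ ∈ gmmCouplings μ ν ∧ IsMinOn cost (gmmCouplings μ ν) γ

/-- The plan `(Id, T)#μ`, also written `μ(x) δ_{y = T(x)}`. -/
noncomputable def graphPlan {d : ℕ} (μ : Measure (Euc d)) (T : Euc d → Euc d) :
    Measure (Euc d × Euc d) :=
  μ.map fun x => (x, T x)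

/-- `T` is an optimal transport map for `W₂` from `μ` to `ν`. -/
def IsW2OptimalMap {d : ℕ} (μ ν : Measure (Euc d)) (T : Euc d → Euc d) : Prop :=
  Measurable T ∧ IsW2OptimalPlan μ ν (graphPlan μ T)

/-- The set `Π(p, q)` of nonnegative matrices with row sums `p` and column sums `q`. -/
def discreteCouplings {K L : ℕ} (p : Fin K → ℝ≥0) (q : Fin L → ℝ≥0) :
    Set (Matrix (Fin K) (Fin L) ℝ≥0) :=
  {w | (∀ k, ∑ l, w k l = p k) ∧ ∀ l, ∑ k, w k l = q l}

/-- The discrete objective `∑_{k,l} w_{kl} W₂²(μ_k, ν_l)`. -/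
noncomputable def discreteCost {d K L : ℕ} (μ : Fin K → Measure (Euc d))
    (ν : Fin L → Measure (Euc d)) (w : Matrix (Fin K) (Fin L) ℝ≥0) : ℝ≥0∞ :=
  ∑ k, ∑ l, (w k l : ℝ≥0∞) * W2sq (μ k) (ν l)

end GMMTransport

/-!
Let `L w = ∑ w_{kl} W₂²(μ₀ᵏ, μ₁ˡ)`. Gluing Gaussian optimal plans between the components along a
discrete coupling `w` gives a Gaussian mixture coupling of cost `L w`. Conversely, let
`γ = ∑ r_j κ_j` be a Gaussian mixture coupling. Its marginals are `∑ r_j fst#κ_j = ∑ π₀ᵏ μ₀ᵏ` and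
`∑ r_j snd#κ_j = ∑ π₁ˡ μ₁ˡ`, and distinct Gaussian measures are linearly independent, so the
weights `r_j` can be distributed over the components of both mixtures in such a way that `j` only
feeds pairs `(k, l)` with `fst#κ_j = μ₀ᵏ` and `snd#κ_j = μ₁ˡ`. The resulting coupling `w` satisfies
`L w ≤ ∑ r_j cost κ_j = cost γ`.

Finitely many distinct Gaussian measures are linearly independent because some linear form gives
them distinct mean-variance pairs `(a, b)`, and then their moment generating functions
`exp (a s + b s² / 2)` along this form have different orders of growth.

Between Gaussian measures, a Gaussian optimal plan exists because the cost of a coupling depends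
only on the covariance of the two coordinates; the joint covariance matrices form a compact set,
and each of them is attained by a Gaussian coupling. If the source covariance is nonsingular, some
affine map with positive semidefinite linear part pushes the source to the target; it is the
gradient of a convex quadratic potential, so by Fenchel-Young duality its graph carries every
optimal plan.
-/

namespace GMMTransport

section LinearIndependence

open Filter Asymptotics

/-- The polynomial hypothesis makes `f i` nonzero off a finite subset of each line through a point
where it is nonzero, so nonvanishing points of the single functions can be joined up one by one. -/
lemma exists_forall_ne_zero_of_polynomial_on_lines {K V ι : Type*} [Field K] [Infinite K]
    [AddCommGroup V] [Module K V] [Finite ι] {f : ι → V → K}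
    (hpoly : ∀ i v w, ∃ P : Polynomial K, ∀ s, f i (v + s • w) = P.eval s)
    (hf : ∀ i, ∃ v, f i v ≠ 0) : ∃ v, ∀ i, f i v ≠ 0 := by
  classical
  have := Fintype.ofFinite ι
  suffices ∀ t : Finset ι, ∃ v, ∀ i ∈ t, f i v ≠ 0 by simpa using this Finset.univ
  intro t
  induction t using Finset.induction_on with
  | empty => exact ⟨0, by simp⟩
  | insert i t _ ih =>
    obtain ⟨v, hv⟩ := ih
    obtain ⟨w, hw⟩ := hf i
    choose P hP using fun j => hpoly j v (w - v)
    have hPt : ∀ j ∈ t, P j ≠ 0 := fun j hj h0 => hv j hj (by simpa [h0] using hP j 0)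
    have hPi : P i ≠ 0 := fun h0 => hw (by simpa [h0] using hP i 1)
    obtain ⟨s, hs⟩ : ∃ s, (∏ j ∈ insert i t, P j).eval s ≠ 0 := by
      by_contra! h
      refine Finset.prod_ne_zero_iff.2 ?_ (Polynomial.funext fun s => by simpa using h s)
      exact Finset.forall_mem_insert _ _ _ |>.2 ⟨hPi, hPt⟩
    rw [Polynomial.eval_prod, Finset.prod_ne_zero_iff] at hs
    exact ⟨v + s • (w - v), fun j hj => by rw [hP]; exact hs j hj⟩

lemma linearIndependent_of_isLittleO {ι X 𝕜 : Type*} [LinearOrder ι] [NormedField 𝕜]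
    {l : Filter X} {f : ι → X → 𝕜} (hf : ∀ i, ∃ᶠ x in l, f i x ≠ 0)
    (hlt : ∀ i j, i < j → f i =o[l] f j) : LinearIndependent 𝕜 f := by
  classical
  rw [linearIndependent_iff']
  intro t c hc
  by_contra! hne
  obtain ⟨i, hi, hmax⟩ := (t.filter (c · ≠ 0)).exists_max_image id
    (by simpa [Finset.Nonempty] using hne)
  simp only [Finset.mem_filter, id] at hi hmax
  have hrest : ∀ j ∈ t.erase i, (c j • f j) =o[l] f i := by
    intro j hj
    obtain ⟨hji, hjt⟩ := Finset.mem_erase.1 hj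
    by_cases hcj : c j = 0
    · rw [hcj, zero_smul]
      exact isLittleO_zero (f i) l
    · exact (hlt j i ((hmax j ⟨hjt, hcj⟩).lt_of_ne hji)).const_mul_left (c j)
  have hsum : (c i • f i) =o[l] f i := by
    rw [eq_neg_of_add_eq_zero_left ((t.add_sum_erase _ hi.1).trans hc)]
    exact (IsLittleO.sum hrest).neg_left.congr_left fun x => by simp
  exact isLittleO_irrefl (hf i) ((isLittleO_const_mul_left_iff hi.2).1 hsum)

lemma isLittleO_exp_quadratic {a b a' b' : ℝ} (h : toLex (b, a) < toLex (b', a')) :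
    (fun s : ℝ => Real.exp (a * s + b * s ^ 2 / 2)) =o[atTop]
      fun s => Real.exp (a' * s + b' * s ^ 2 / 2) := by
  rw [Real.isLittleO_exp_comp_exp_comp]
  rcases Prod.Lex.toLex_lt_toLex.1 h with hb | ⟨rfl, ha⟩
  · have hlin : Tendsto (fun s : ℝ => (a' - a) + (b' - b) / 2 * s) atTop atTop :=
      tendsto_atTop_add_const_left _ _ (tendsto_id.const_mul_atTop (half_pos (sub_pos.2 hb)))
    exact (tendsto_id.atTop_mul_atTop₀ hlin).congr fun s => by simp only [id]; ring
  · exact (tendsto_id.const_mul_atTop (sub_pos.2 ha)).congr fun s => by simp only [id]; ring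

lemma linearIndependent_exp_quadratic : LinearIndependent ℝ
    fun (p : ℝ × ℝ) (s : ℝ) => Real.exp (p.1 * s + p.2 * s ^ 2 / 2) := by
  let f : ℝ ×ₗ ℝ → ℝ → ℝ := fun p s => Real.exp ((ofLex p).2 * s + (ofLex p).1 * s ^ 2 / 2)
  have hf : LinearIndependent ℝ f := by
    refine linearIndependent_of_isLittleO (l := atTop) (fun p => ?_) fun p q hpq => ?_
    · exact (Eventually.of_forall fun s => (Real.exp_pos _).ne').frequently
    · exact isLittleO_exp_quadratic (show toLex (ofLex p) < toLex (ofLex q) from hpq)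
  have hinj : Function.Injective fun p : ℝ × ℝ => toLex p.swap :=
    toLex.injective.comp Prod.swap_injective
  simpa only [f, Function.comp_def, ofLex_toLex, Prod.fst_swap, Prod.snd_swap] using
    hf.comp _ hinj

end LinearIndependence

section Identifiability

open Polynomial

variable {E : Type*} [NormedAddCommGroup E] [NormedSpace ℝ E] [MeasurableSpace E] [BorelSpace E]

lemma integrable_exp_mul_dual_of_isGaussian (μ : Measure E) [IsGaussian μ] (L : StrongDual ℝ E)
    (s : ℝ) : Integrable (fun x => Real.exp (s * L x)) μ := by
  have h := integrable_exp_mul_gaussianReal (μ := ∫ x, L x ∂μ) (v := Var[L; μ].toNNReal) s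
  rw [← IsGaussian.map_eq_gaussianReal L] at h
  exact h.comp_aemeasurable (by fun_prop)

variable [CompleteSpace E] [SecondCountableTopology E]

lemma mgf_dual_of_isGaussian (μ : Measure E) [IsGaussian μ] (L : StrongDual ℝ E) (s : ℝ) :
    mgf L μ s = Real.exp (L (∫ x, x ∂μ) * s + covarianceBilinDual μ L L * s ^ 2 / 2) := by
  rw [mgf_gaussianReal (IsGaussian.map_eq_gaussianReal L), IsGaussian.integral_dual,
    covarianceBilinDual_self_eq_variance IsGaussian.memLp_two_id,
    Real.coe_toNNReal _ (variance_nonneg _ _)]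

lemma isGaussian_ext_dual {μ ν : Measure E} [IsGaussian μ] [IsGaussian ν]
    (hmean : ∀ L : StrongDual ℝ E, L (∫ x, x ∂μ) = L (∫ x, x ∂ν))
    (hcov : ∀ L, covarianceBilinDual μ L L = covarianceBilinDual ν L L) : μ = ν :=
  Measure.ext_of_charFunDual <| funext fun L => by
    simp only [IsGaussian.charFunDual_eq', id, hmean, hcov]

lemma exists_dual_injective_of_isGaussian {ι : Type*} [Finite ι] {α : ι → Measure E}
    (hα : Function.Injective α) (hG : ∀ i, IsGaussian (α i)) :
    ∃ L : StrongDual ℝ E, Function.Injective fun i =>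
      (L (∫ x, x ∂α i), covarianceBilinDual (α i) L L) := by
  let f : {p : ι × ι // p.1 ≠ p.2} → StrongDual ℝ E → ℝ := fun p L =>
    (L (∫ x, x ∂α p.1.1) - L (∫ x, x ∂α p.1.2)) ^ 2 +
      (covarianceBilinDual (α p.1.1) L L - covarianceBilinDual (α p.1.2) L L) ^ 2
  obtain ⟨L, hL⟩ : ∃ L, ∀ p, f p L ≠ 0 := by
    refine exists_forall_ne_zero_of_polynomial_on_lines (K := ℝ) (fun p L M => ?_) fun p => ?_
    · classical
      let u := fun M : StrongDual ℝ E => M (∫ x, x ∂α p.1.1) - M (∫ x, x ∂α p.1.2)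
      let B := fun M N : StrongDual ℝ E =>
        covarianceBilinDual (α p.1.1) M N - covarianceBilinDual (α p.1.2) M N
      refine ⟨(C (u L) + C (u M) * X) ^ 2 +
        (C (B L L) + C (B L M + B M L) * X + C (B M M) * X ^ 2) ^ 2, fun s => ?_⟩
      simp [f, u, B]
      ring
    · have := hG p.1.1
      have := hG p.1.2
      by_contra! h
      have hzero := fun L => (add_eq_zero_iff_of_nonneg (sq_nonneg _) (sq_nonneg _)).1 (h L)
      simp only [sq_eq_zero_iff, sub_eq_zero] at hzero
      exact p.2 (hα (isGaussian_ext_dual (fun L => (hzero L).1) fun L => (hzero L).2))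
  refine ⟨L, fun i j hij => by_contra fun hne => hL ⟨(i, j), hne⟩ ?_⟩
  obtain ⟨hmean, hcov⟩ := Prod.mk.inj hij
  simp [f, hmean, hcov]

lemma mgf_dual_sum_smul_of_isGaussian {ι : Type*} [Fintype ι] (p : ι → ℝ≥0) {α : ι → Measure E}
    (hG : ∀ i, IsGaussian (α i)) (L : StrongDual ℝ E) (s : ℝ) :
    mgf L (∑ i, p i • α i) s = ∑ i, p i *
      Real.exp (L (∫ x, x ∂α i) * s + covarianceBilinDual (α i) L L * s ^ 2 / 2) := by
  have hint : ∀ i ∈ Finset.univ, Integrable (fun x => Real.exp (s * L x)) (p i • α i) :=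
    fun i _ => (integrable_exp_mul_dual_of_isGaussian (α i) L s).smul_measure_nnreal
  rw [mgf, integral_finsetSum_measure hint]
  refine Finset.sum_congr rfl fun i _ => ?_
  rw [integral_smul_nnreal_measure, ← mgf_dual_of_isGaussian, mgf, NNReal.smul_def, smul_eq_mul]

theorem linearIndepOn_isGaussian :
    LinearIndepOn ℝ≥0 id {μ : Measure E | IsGaussian μ} := by
  rw [LinearIndepOn, linearIndependent_iff_finset_linearIndependent]
  intro t
  rw [Fintype.linearIndependent_iffₛ]
  intro p q hpq
  let α : t → Measure E := fun i => i.1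
  have hG : ∀ i, IsGaussian (α i) := fun i => i.1.2
  obtain ⟨L, hL⟩ := exists_dual_injective_of_isGaussian
    (Subtype.val_injective.comp Subtype.val_injective : Function.Injective α) hG
  have hexp := Fintype.linearIndependent_iff.1 (linearIndependent_exp_quadratic.comp _ hL)
  have hdiff := hexp (fun i => (p i : ℝ) - q i) <| funext fun s => by
    have hmgf : mgf L (∑ i, p i • α i) s = mgf L (∑ i, q i • α i) s := congrArg (mgf L · s) hpq
    rw [mgf_dual_sum_smul_of_isGaussian p hG, mgf_dual_sum_smul_of_isGaussian q hG] at hmgf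
    simpa [sub_mul] using sub_eq_zero.2 hmgf
  exact fun i => NNReal.coe_injective (sub_eq_zero.1 (hdiff i))

end Identifiability

section Couplings

variable {d : ℕ} {μ ν : Measure (Euc d)} {γ γ' : Measure (Euc d × Euc d)}

lemma map_prodMk_mem_couplings {Ω : Type*} [MeasurableSpace Ω] {P : Measure Ω}
    [IsProbabilityMeasure P] {X Y : Ω → Euc d} (hX : Measurable X) (hY : Measurable Y) :
    P.map (fun ω => (X ω, Y ω)) ∈ couplings (P.map X) (P.map Y) :=
  ⟨Measure.isProbabilityMeasure_map (hX.prodMk hY).aemeasurable,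
    Measure.fst_map_prodMk hY, Measure.snd_map_prodMk hX⟩

lemma prod_mem_couplings [IsProbabilityMeasure μ] [IsProbabilityMeasure ν] :
    μ.prod ν ∈ couplings μ ν :=
  ⟨inferInstance, by simp, by simp⟩

lemma graphPlan_mem_couplings [IsProbabilityMeasure μ] {T : Euc d → Euc d} (hT : Measurable T) :
    graphPlan μ T ∈ couplings μ (μ.map T) := by
  simpa only [graphPlan, Measure.map_id'] using map_prodMk_mem_couplings measurable_id' hT

lemma cost_eq_W2sq (h : IsW2OptimalPlan μ ν γ) : cost γ = W2sq μ ν :=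
  le_antisymm (le_iInf₂ fun _ hγ' => h.2 hγ') (iInf₂_le γ h.1)

lemma memLp_fst_of_coupling (hμ : MemLp id 2 μ) (hγ : γ ∈ couplings μ ν) :
    MemLp (fun z : Euc d × Euc d => z.1) 2 γ := by
  rw [← hγ.2.1] at hμ
  exact hμ.comp_of_map measurable_fst.aemeasurable

lemma memLp_snd_of_coupling (hν : MemLp id 2 ν) (hγ : γ ∈ couplings μ ν) :
    MemLp (fun z : Euc d × Euc d => z.2) 2 γ := by
  rw [← hγ.2.2] at hν
  exact hν.comp_of_map measurable_snd.aemeasurable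

lemma integrable_inner_of_memLp {Ω F : Type*} [NormedAddCommGroup F] [InnerProductSpace ℝ F]
    [MeasurableSpace Ω] {P : Measure Ω} {f g : Ω → F} (hf : MemLp f 2 P) (hg : MemLp g 2 P) :
    Integrable (fun ω => inner ℝ (f ω) (g ω)) P :=
  (hf.norm.integrable_mul hg.norm).mono' (hf.1.inner hg.1)
    (ae_of_all _ fun _ => norm_inner_le_norm _ _)

lemma integrable_inner_of_coupling (hμ : MemLp id 2 μ) (hν : MemLp id 2 ν)
    (hγ : γ ∈ couplings μ ν) : Integrable (fun z : Euc d × Euc d => inner ℝ z.1 z.2) γ :=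
  integrable_inner_of_memLp (memLp_fst_of_coupling hμ hγ) (memLp_snd_of_coupling hν hγ)

lemma integrable_add_of_coupling {φ ψ : Euc d → ℝ} (hφ : Integrable φ μ) (hψ : Integrable ψ ν)
    (hγ : γ ∈ couplings μ ν) : Integrable (fun z : Euc d × Euc d => φ z.1 + ψ z.2) γ := by
  rw [← hγ.2.1] at hφ
  rw [← hγ.2.2] at hψ
  exact (hφ.comp_measurable measurable_fst).add (hψ.comp_measurable measurable_snd)

lemma integral_add_of_coupling {φ ψ : Euc d → ℝ} (hφ : Integrable φ μ) (hψ : Integrable ψ ν)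
    (hγ : γ ∈ couplings μ ν) :
    ∫ z, φ z.1 + ψ z.2 ∂γ = ∫ x, φ x ∂μ + ∫ y, ψ y ∂ν := by
  obtain ⟨-, rfl, rfl⟩ := hγ
  rw [integral_map measurable_fst.aemeasurable hφ.1, integral_map measurable_snd.aemeasurable hψ.1]
  exact integral_add (hφ.comp_measurable measurable_fst) (hψ.comp_measurable measurable_snd)

lemma cost_eq_ofReal_integral (hμ : MemLp id 2 μ) (hν : MemLp id 2 ν) (hγ : γ ∈ couplings μ ν) :
    cost γ = ENNReal.ofReal (∫ z, ‖z.1 - z.2‖ ^ 2 ∂γ) := by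
  have hint : Integrable (fun z : Euc d × Euc d => ‖z.1 - z.2‖ ^ 2) γ :=
    ((memLp_fst_of_coupling hμ hγ).sub (memLp_snd_of_coupling hν hγ)).integrable_norm_pow (by simp)
  rw [ofReal_integral_eq_lintegral_ofReal hint (ae_of_all _ fun z => by positivity), cost]
  refine lintegral_congr fun z => ?_
  rw [ENNReal.ofReal_pow (norm_nonneg _), ofReal_norm]

lemma integral_norm_sub_sq_of_coupling (hμ : MemLp id 2 μ) (hν : MemLp id 2 ν)
    (hγ : γ ∈ couplings μ ν) :
    ∫ z, ‖z.1 - z.2‖ ^ 2 ∂γ =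
      ∫ x, ‖x‖ ^ 2 ∂μ + ∫ y, ‖y‖ ^ 2 ∂ν - 2 * ∫ z, inner ℝ z.1 z.2 ∂γ := by
  have hsqμ : Integrable (fun x => ‖x‖ ^ 2) μ := hμ.integrable_norm_pow (by simp)
  have hsqν : Integrable (fun y => ‖y‖ ^ 2) ν := hν.integrable_norm_pow (by simp)
  rw [← integral_add_of_coupling hsqμ hsqν hγ, ← integral_const_mul,
    ← integral_sub (integrable_add_of_coupling hsqμ hsqν hγ)
      ((integrable_inner_of_coupling hμ hν hγ).const_mul 2)]
  refine integral_congr_ae (ae_of_all _ fun z => ?_)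
  simp only [norm_sub_sq_real]
  ring

lemma cost_le_cost_iff (hμ : MemLp id 2 μ) (hν : MemLp id 2 ν) (hγ : γ ∈ couplings μ ν)
    (hγ' : γ' ∈ couplings μ ν) :
    cost γ ≤ cost γ' ↔ ∫ z, inner ℝ z.1 z.2 ∂γ' ≤ ∫ z, inner ℝ z.1 z.2 ∂γ := by
  rw [cost_eq_ofReal_integral hμ hν hγ, cost_eq_ofReal_integral hμ hν hγ',
    ENNReal.ofReal_le_ofReal_iff (integral_nonneg fun z => by positivity),
    integral_norm_sub_sq_of_coupling hμ hν hγ, integral_norm_sub_sq_of_coupling hμ hν hγ']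
  constructor <;> intro h <;> linarith

lemma W2sq_ne_top [IsProbabilityMeasure μ] [IsProbabilityMeasure ν] (hμ : MemLp id 2 μ)
    (hν : MemLp id 2 ν) : W2sq μ ν ≠ ∞ := by
  refine ne_top_of_le_ne_top ?_ (iInf₂_le (μ.prod ν) prod_mem_couplings)
  rw [cost_eq_ofReal_integral hμ hν prod_mem_couplings]
  exact ENNReal.ofReal_ne_top

lemma isW2OptimalPlan_iff_of_potentials (hμ : MemLp id 2 μ) (hν : MemLp id 2 ν) {φ ψ : Euc d → ℝ}
    (hφ : Integrable φ μ) (hψ : Integrable ψ ν) (hle : ∀ᵐ y ∂ν, ∀ x, inner ℝ x y ≤ φ x + ψ y)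
    {γ₀ : Measure (Euc d × Euc d)} (hγ₀ : γ₀ ∈ couplings μ ν)
    (heq : ∀ᵐ z ∂γ₀, inner ℝ z.1 z.2 = φ z.1 + ψ z.2) (hγ : γ ∈ couplings μ ν) :
    IsW2OptimalPlan μ ν γ ↔ ∀ᵐ z ∂γ, inner ℝ z.1 z.2 = φ z.1 + ψ z.2 := by
  have hduality {π : Measure (Euc d × Euc d)} (hπ : π ∈ couplings μ ν) :
      (fun z : Euc d × Euc d => inner ℝ z.1 z.2) ≤ᵐ[π] fun z => φ z.1 + ψ z.2 := by
    rw [← hπ.2.2] at hle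
    filter_upwards [ae_of_ae_map measurable_snd.aemeasurable hle] with z hz using hz z.1
  have hweak {π : Measure (Euc d × Euc d)} (hπ : π ∈ couplings μ ν) :
      ∫ z, inner ℝ z.1 z.2 ∂π ≤ ∫ x, φ x ∂μ + ∫ y, ψ y ∂ν := by
    rw [← integral_add_of_coupling hφ hψ hπ]
    exact integral_mono_ae (integrable_inner_of_coupling hμ hν hπ)
      (integrable_add_of_coupling hφ hψ hπ) (hduality hπ)
  have hslack {π : Measure (Euc d × Euc d)} (hπ : π ∈ couplings μ ν) :
      ∫ z, inner ℝ z.1 z.2 ∂π = ∫ x, φ x ∂μ + ∫ y, ψ y ∂ν ↔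
        ∀ᵐ z ∂π, inner ℝ z.1 z.2 = φ z.1 + ψ z.2 := by
    rw [← integral_add_of_coupling hφ hψ hπ]
    exact integral_eq_iff_of_ae_le (integrable_inner_of_coupling hμ hν hπ)
      (integrable_add_of_coupling hφ hψ hπ) (hduality hπ)
  rw [← hslack hγ]
  constructor
  · intro hopt
    refine (hweak hγ).antisymm ?_
    rw [← (hslack hγ₀).2 heq]
    exact (cost_le_cost_iff hμ hν hγ hγ₀).1 (hopt.2 hγ₀)
  · exact fun h => ⟨hγ, fun π hπ => (cost_le_cost_iff hμ hν hγ hπ).2 (h ▸ hweak hπ)⟩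

end Couplings

section AffineMaps

lemma apply_eq_zero_of_inner_apply_self_eq_zero {F : Type*} [NormedAddCommGroup F]
    [InnerProductSpace ℝ F] {A : F →L[ℝ] F} (hA : A.IsPositive) {u : F}
    (hu : inner ℝ (A u) u = 0) : A u = 0 := by
  let B : LinearMap.BilinForm ℝ F := (innerₗ F).comp (A : F →ₗ[ℝ] F)
  have hB : LinearMap.IsSymm B := ⟨fun x y => by
    simpa [B, real_inner_comm] using hA.inner_left_eq_inner_right x y⟩
  have hker := (B.apply_apply_same_eq_zero_iff hA.inner_nonneg_left hB).1 hu
  exact inner_self_eq_zero.1 (LinearMap.congr_fun hker (A u))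

lemma exists_apply_apply_apply_eq {K V W : Type*} [Field K] [AddCommGroup V] [Module K V]
    [AddCommGroup W] [Module K W] (f : V →ₗ[K] W) :
    ∃ g : W →ₗ[K] V, ∀ x, f (g (f x)) = f x := by
  obtain ⟨h, hh⟩ := f.rangeRestrict.exists_rightInverse_of_surjective f.range_rangeRestrict
  obtain ⟨g, hg⟩ := h.exists_extend
  refine ⟨g, fun x => ?_⟩
  have hgx : g (f x) = h (f.rangeRestrict x) := LinearMap.congr_fun hg (f.rangeRestrict x)
  rw [hgx]
  exact congrArg Subtype.val (LinearMap.congr_fun hh (f.rangeRestrict x))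

section QuadraticPotentials

variable {F : Type*} [NormedAddCommGroup F] [InnerProductSpace ℝ F] {A G : F →L[ℝ] F} {b x y : F}

/-- The quadratic function with gradient `x ↦ A x + b`, for symmetric `A`: the Kantorovich
potential of that affine map. -/
noncomputable def quadPotential (A : F →L[ℝ] F) (b x : F) : ℝ :=
  inner ℝ (A x) x / 2 + inner ℝ x b

/-- The Legendre transform of `quadPotential A b` at the points `y` with
`A (G (y - b)) = y - b`. It is encoded by a generalized inverse `G` since `A` may be singular. -/
noncomputable def quadPotentialConj (G : F →L[ℝ] F) (b y : F) : ℝ :=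
  inner ℝ (G (y - b)) (y - b) / 2

lemma quadPotential_add_conj_sub_inner (hA : A.IsPositive) (hy : A (G (y - b)) = y - b) :
    quadPotential A b x + quadPotentialConj G b y - inner ℝ x y =
      inner ℝ (A (x - G (y - b))) (x - G (y - b)) / 2 := by
  have hcross : inner ℝ (A x) (G (y - b)) = inner ℝ x (y - b) := by
    rw [hA.inner_left_eq_inner_right, hy]
  rw [quadPotential, quadPotentialConj, map_sub A x, hy, inner_sub_left (A x),
    inner_sub_right (A x), inner_sub_right (y - b) x, hcross, real_inner_comm x (y - b),
    real_inner_comm (G (y - b)) (y - b), inner_sub_right x]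
  ring

lemma inner_le_quadPotential_add_conj (hA : A.IsPositive) (hy : A (G (y - b)) = y - b) :
    inner ℝ x y ≤ quadPotential A b x + quadPotentialConj G b y := by
  rw [← sub_nonneg, quadPotential_add_conj_sub_inner hA hy]
  exact div_nonneg (hA.inner_nonneg_left _) two_pos.le

lemma inner_eq_quadPotential_add_conj_iff (hA : A.IsPositive) (hG : ∀ x, A (G (A x)) = A x)
    (hy : A (G (y - b)) = y - b) :
    inner ℝ x y = quadPotential A b x + quadPotentialConj G b y ↔ y = A x + b := by
  rw [eq_comm, ← sub_eq_zero, quadPotential_add_conj_sub_inner hA hy]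
  constructor
  · intro h
    have hzero := apply_eq_zero_of_inner_apply_self_eq_zero hA (by linarith)
    rw [map_sub, hy, sub_eq_zero] at hzero
    rw [hzero, sub_add_cancel]
  · rintro rfl
    simp [hG]

variable [MeasurableSpace F] {μ : Measure F} [IsFiniteMeasure μ]

lemma integrable_quadPotential (A : F →L[ℝ] F) (b : F) (hμ : MemLp id 2 μ) :
    Integrable (quadPotential A b) μ :=
  ((integrable_inner_of_memLp (A.comp_memLp' hμ) hμ).div_const 2).add
    (integrable_inner_of_memLp hμ (memLp_const b))

lemma integrable_quadPotentialConj (G : F →L[ℝ] F) (b : F) (hμ : MemLp id 2 μ) :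
    Integrable (quadPotentialConj G b) μ := by
  have hsub : MemLp (fun y => y - b) 2 μ := hμ.sub (memLp_const b)
  exact (integrable_inner_of_memLp (G.comp_memLp' hsub) hsub).div_const 2

end QuadraticPotentials

variable {d : ℕ} {μ ν : Measure (Euc d)} {γ : Measure (Euc d × Euc d)}

lemma ae_graphPlan_iff {T S : Euc d → Euc d} (hT : Measurable T) (hS : Measurable S) :
    (∀ᵐ z ∂graphPlan μ T, z.2 = S z.1) ↔ T =ᵐ[μ] S :=
  ae_map_iff (by fun_prop) (measurableSet_eq_fun measurable_snd (by fun_prop))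

theorem isW2OptimalPlan_iff_of_affine [IsProbabilityMeasure μ] {A : Euc d →L[ℝ] Euc d}
    (hA : A.IsPositive) {b : Euc d} (hμ : MemLp id 2 μ) (hν : ν = μ.map fun x => A x + b)
    (hγ : γ ∈ couplings μ ν) :
    IsW2OptimalPlan μ ν γ ↔ ∀ᵐ z ∂γ, z.2 = A z.1 + b := by
  have hT : Measurable fun x => A x + b := by fun_prop
  have : IsProbabilityMeasure ν := hν ▸ Measure.isProbabilityMeasure_map hT.aemeasurable
  have hν2 : MemLp id 2 ν := by
    rw [hν, memLp_map_measure_iff (by fun_prop) hT.aemeasurable]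
    exact (A.comp_memLp' hμ).add (memLp_const b)
  obtain ⟨g, hg⟩ := exists_apply_apply_apply_eq (A : Euc d →ₗ[ℝ] Euc d)
  let G : Euc d →L[ℝ] Euc d := LinearMap.toContinuousLinearMap g
  have hG : ∀ x, A (G (A x)) = A x := hg
  have hGν : ∀ᵐ y ∂ν, A (G (y - b)) = y - b := by
    rw [hν, ae_map_iff hT.aemeasurable (measurableSet_eq_fun (by fun_prop) (by fun_prop))]
    exact ae_of_all _ fun x => by simp [hG]
  have hcontact {π : Measure (Euc d × Euc d)} (hπ : π ∈ couplings μ ν) :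
      (∀ᵐ z ∂π, inner ℝ z.1 z.2 = quadPotential A b z.1 + quadPotentialConj G b z.2) ↔
        ∀ᵐ z ∂π, z.2 = A z.1 + b := by
    rw [← hπ.2.2] at hGν
    refine Filter.eventually_congr ?_
    filter_upwards [ae_of_ae_map measurable_snd.aemeasurable hGν] with z hz
    exact inner_eq_quadPotential_add_conj_iff hA hG hz
  have hgraph : graphPlan μ (fun x => A x + b) ∈ couplings μ ν := hν ▸ graphPlan_mem_couplings hT
  rw [← hcontact hγ]
  exact isW2OptimalPlan_iff_of_potentials hμ hν2 (integrable_quadPotential A b hμ)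
    (integrable_quadPotentialConj G b hν2)
    (hGν.mono fun y hy x => inner_le_quadPotential_add_conj hA hy) hgraph
    ((hcontact hgraph).2 ((ae_graphPlan_iff hT hT).2 .rfl)) hγ

lemma isW2OptimalMap_iff_of_affine [IsProbabilityMeasure μ] {A : Euc d →L[ℝ] Euc d}
    (hA : A.IsPositive) {b : Euc d} (hμ : MemLp id 2 μ) (hν : ν = μ.map fun x => A x + b)
    {T : Euc d → Euc d} (hT : Measurable T) :
    IsW2OptimalMap μ ν T ↔ T =ᵐ[μ] fun x => A x + b := by
  rw [← ae_graphPlan_iff hT (by fun_prop)]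
  constructor
  · exact fun h => (isW2OptimalPlan_iff_of_affine hA hμ hν h.2.1).1 h.2
  · intro h
    have hmap : μ.map T = ν := hν ▸ Measure.map_congr ((ae_graphPlan_iff hT (by fun_prop)).1 h)
    have hγ : graphPlan μ T ∈ couplings μ ν := hmap ▸ graphPlan_mem_couplings hT
    exact ⟨hT, (isW2OptimalPlan_iff_of_affine hA hμ hν hγ).2 h⟩

end AffineMaps

section CovarianceMatrices

/-- The covariance matrix of a random vector with square integrable coordinates `X i`. -/
noncomputable def covarianceMatrix {Ω ι : Type*} [MeasurableSpace Ω] (X : ι → Ω → ℝ)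
    (P : Measure Ω) : Matrix ι ι ℝ :=
  Matrix.of fun i j => cov[X i, X j; P]

lemma posSemidef_covarianceMatrix {Ω ι : Type*} [MeasurableSpace Ω] [Finite ι] {P : Measure Ω}
    [IsFiniteMeasure P] {X : ι → Ω → ℝ} (hX : ∀ i, MemLp (X i) 2 P) :
    (covarianceMatrix X P).PosSemidef := by
  have := Fintype.ofFinite ι
  refine .of_dotProduct_mulVec_nonneg ?_ fun x => ?_
  · ext i j
    exact covariance_comm _ _
  · have hnonneg := covarianceBilin_self_nonneg (μ := P.map fun ω => WithLp.toLp 2 (X · ω))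
      (WithLp.toLp 2 x)
    rw [covarianceBilin_apply_pi hX] at hnonneg
    refine hnonneg.trans_eq ?_
    simp only [dotProduct, Matrix.mulVec, covarianceMatrix, Matrix.of_apply, Finset.mul_sum,
      Pi.star_apply, star_trivial]
    exact Finset.sum_congr rfl fun i _ => Finset.sum_congr rfl fun j _ => by ring

lemma isClosed_setOf_posSemidef {ι : Type*} [Finite ι] :
    IsClosed {F : Matrix ι ι ℝ | F.PosSemidef} := by
  have := Fintype.ofFinite ι
  simp only [Matrix.posSemidef_iff_dotProduct_mulVec, Set.ofPred_and, Set.ofPred_forall]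
  refine IsClosed.inter ?_ (isClosed_iInter fun x => ?_)
  · exact isClosed_eq (by fun_prop) (by fun_prop)
  · exact isClosed_le (by fun_prop) (by fun_prop)

lemma abs_apply_le_of_posSemidef {ι : Type*} {F : Matrix ι ι ℝ} (hF : F.PosSemidef) (i j : ι) :
    |F i j| ≤ (F i i + F j j) / 2 := by
  have hsymm : F j i = F i j := by simpa using hF.1.apply i j
  have hminor := (hF.submatrix ![i, j]).dotProduct_mulVec_nonneg
  have hadd := hminor ![1, 1]
  have hsub := hminor ![1, -1]
  simp only [dotProduct, Matrix.mulVec, Fin.sum_univ_two, Pi.star_apply, star_trivial,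
    Matrix.submatrix_apply, Matrix.cons_val_zero, Matrix.cons_val_one, hsymm] at hadd hsub
  rw [abs_le]
  constructor <;> linarith

/-- The covariance matrices on `ℝ^ι × ℝ^κ` with prescribed diagonal blocks, which are those of the
couplings of two measures with covariance matrices `S₀` and `S₁`. -/
def blockCovariances {ι κ : Type*} (S₀ : Matrix ι ι ℝ) (S₁ : Matrix κ κ ℝ) :
    Set (Matrix (ι ⊕ κ) (ι ⊕ κ) ℝ) :=
  {F | F.PosSemidef ∧ F.toBlocks₁₁ = S₀ ∧ F.toBlocks₂₂ = S₁}

lemma isCompact_blockCovariances {ι κ : Type*} [Finite ι] [Finite κ] (S₀ : Matrix ι ι ℝ)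
    (S₁ : Matrix κ κ ℝ) : IsCompact (blockCovariances S₀ S₁) := by
  let D : ι ⊕ κ → ℝ := Sum.elim S₀.diag S₁.diag
  have hbox : IsCompact (Set.univ.pi fun a => Set.univ.pi fun b =>
      Set.Icc (-((D a + D b) / 2)) ((D a + D b) / 2) : Set (Matrix (ι ⊕ κ) (ι ⊕ κ) ℝ)) :=
    isCompact_univ_pi fun _ => isCompact_univ_pi fun _ => isCompact_Icc
  have hclosed : IsClosed (blockCovariances S₀ S₁) := by
    refine isClosed_setOf_posSemidef.inter (IsClosed.inter ?_ ?_)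
    · exact isClosed_eq (by unfold Matrix.toBlocks₁₁; fun_prop) (by fun_prop)
    · exact isClosed_eq (by unfold Matrix.toBlocks₂₂; fun_prop) (by fun_prop)
  refine hbox.of_isClosed_subset hclosed ?_
  rintro F ⟨hF, rfl, rfl⟩ a - b -
  have hdiag : ∀ a, F a a = D a := Sum.rec (fun _ => rfl) fun _ => rfl
  simpa only [hdiag, abs_le, Set.mem_Icc] using abs_apply_le_of_posSemidef hF a b

end CovarianceMatrices

section GaussianImages

variable {ι κ : Type*} [Fintype ι] [DecidableEq ι] [Fintype κ] [DecidableEq κ]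
  {m : EuclideanSpace ℝ ι} {S : Matrix ι ι ℝ}

lemma map_toEuclideanLin_add_multivariateGaussian (hS : S.PosSemidef) (A : Matrix κ ι ℝ)
    (b : EuclideanSpace ℝ κ) :
    (multivariateGaussian m S).map (fun x => Matrix.toEuclideanLin A x + b) =
      multivariateGaussian (Matrix.toEuclideanLin A m + b) (A * S * A.transpose) := by
  let L : EuclideanSpace ℝ ι →L[ℝ] EuclideanSpace ℝ κ :=
    LinearMap.toContinuousLinearMap (Matrix.toEuclideanLin A)
  have hL (y : EuclideanSpace ℝ κ) :
      WithLp.ofLp (L.adjoint y) = Matrix.mulVec A.transpose (WithLp.ofLp y) := by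
    rw [← LinearMap.adjoint_toContinuousLinearMap, ← Matrix.toEuclideanLin_conjTranspose_eq_adjoint,
      Matrix.conjTranspose_eq_transpose_of_trivial]
    rfl
  have hmap : (multivariateGaussian m S).map (fun x => Matrix.toEuclideanLin A x + b) =
      ((multivariateGaussian m S).map L).map fun y => b + y := by
    rw [Measure.map_map (by fun_prop) (by fun_prop)]
    congr 1
    exact funext fun x => add_comm (L x) b
  rw [hmap]
  have hprob := Measure.isProbabilityMeasure_map (μ := multivariateGaussian m S)
    L.continuous.aemeasurable
  have hSA : (A * S * A.transpose).PosSemidef := by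
    simpa using hS.mul_mul_conjTranspose_same A
  apply IsGaussian.ext
  · have hint : Integrable (fun y => y) ((multivariateGaussian m S).map L) :=
      IsGaussian.integrable_id
    simp only [id_eq, integral_id_multivariateGaussian]
    rw [integral_map (by fun_prop) (by fun_prop), integral_add (integrable_const _) hint,
      L.integral_id_map IsGaussian.integrable_id, integral_id_multivariateGaussian,
      integral_const, probReal_univ, one_smul, add_comm]
    rfl
  · ext x y
    rw [covarianceBilin_map_const_add, covarianceBilin_map IsGaussian.memLp_two_id,
      covarianceBilin_multivariateGaussian hS, covarianceBilin_multivariateGaussian hSA, hL, hL,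
      ← Matrix.mulVec_mulVec, ← Matrix.mulVec_mulVec, Matrix.dotProduct_mulVec _ A,
      ← Matrix.mulVec_transpose]

lemma map_comp_multivariateGaussian (hS : S.PosSemidef) (f : κ → ι) :
    (multivariateGaussian m S).map (fun x => WithLp.toLp 2 fun k => x (f k)) =
      multivariateGaussian (WithLp.toLp 2 fun k => m (f k)) (S.submatrix f f) := by
  let A : Matrix κ ι ℝ := (1 : Matrix ι ι ℝ).submatrix f id
  have hA (x : EuclideanSpace ℝ ι) :
      Matrix.toEuclideanLin A x = WithLp.toLp 2 fun k => x (f k) := by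
    ext k
    simp [A, Matrix.mulVec, dotProduct, Matrix.one_apply]
  have hS' : A * S * A.transpose = S.submatrix f f := by
    ext k l
    simp [A, Matrix.mul_apply, Matrix.one_apply]
  simpa only [hA, hS', add_zero] using map_toEuclideanLin_add_multivariateGaussian hS A 0

end GaussianImages

section GaussianPlans

variable {d : ℕ} {m₀ m₁ : Euc d} {S₀ S₁ : Matrix (Fin d) (Fin d) ℝ}
  {F : Matrix (Fin d ⊕ Fin d) (Fin d ⊕ Fin d) ℝ} {γ : Measure (Euc d × Euc d)}

/-- The Gaussian measure on `ℝ^d × ℝ^d` with means `m₀`, `m₁` and covariance matrix `F`. -/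
noncomputable def blockGaussian (m₀ m₁ : Euc d) (F : Matrix (Fin d ⊕ Fin d) (Fin d ⊕ Fin d) ℝ) :
    Measure (Euc d × Euc d) :=
  (multivariateGaussian (EuclideanSpace.sumEquivProd.symm (m₀, m₁)) F).map
    EuclideanSpace.sumEquivProd

instance (m₀ m₁ : Euc d) (F : Matrix (Fin d ⊕ Fin d) (Fin d ⊕ Fin d) ℝ) :
    IsGaussian (blockGaussian m₀ m₁ F) :=
  isGaussian_map_equiv _

lemma blockGaussian_mem_couplings (hF : F ∈ blockCovariances S₀ S₁) :
    blockGaussian m₀ m₁ F ∈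
      couplings (multivariateGaussian m₀ S₀) (multivariateGaussian m₁ S₁) := by
  obtain ⟨hF, rfl, rfl⟩ := hF
  have hfst := map_comp_multivariateGaussian
    (m := EuclideanSpace.sumEquivProd.symm (m₀, m₁)) hF (Sum.inl : Fin d → Fin d ⊕ Fin d)
  have hsnd := map_comp_multivariateGaussian
    (m := EuclideanSpace.sumEquivProd.symm (m₀, m₁)) hF (Sum.inr : Fin d → Fin d ⊕ Fin d)
  exact hfst ▸ hsnd ▸ map_prodMk_mem_couplings (by fun_prop) (by fun_prop)

/-- The covariance matrix of a measure on `ℝ^d × ℝ^d`. -/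
noncomputable def jointCovariance (γ : Measure (Euc d × Euc d)) :
    Matrix (Fin d ⊕ Fin d) (Fin d ⊕ Fin d) ℝ :=
  covarianceMatrix (fun a z => Sum.elim z.1 z.2 a) γ

lemma jointCovariance_blockGaussian (hF : F.PosSemidef) :
    jointCovariance (blockGaussian m₀ m₁ F) = F := by
  have hmeas : ∀ a : Fin d ⊕ Fin d, Measurable fun z : Euc d × Euc d => Sum.elim z.1 z.2 a :=
    Sum.rec (fun _ => by simp only [Sum.elim_inl]; fun_prop)
      fun _ => by simp only [Sum.elim_inr]; fun_prop
  have heval (a : Fin d ⊕ Fin d) (x : EuclideanSpace ℝ (Fin d ⊕ Fin d)) :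
      Sum.elim (EuclideanSpace.sumEquivProd x).1 (EuclideanSpace.sumEquivProd x).2 a = x a := by
    cases a <;> rfl
  ext a b
  rw [jointCovariance, covarianceMatrix, Matrix.of_apply, blockGaussian,
    covariance_map_fun (hmeas a).aestronglyMeasurable (hmeas b).aestronglyMeasurable
      (by fun_prop)]
  simp only [heval]
  exact covariance_eval_multivariateGaussian hF a b

lemma jointCovariance_mem_blockCovariances (hS₀ : S₀.PosSemidef) (hS₁ : S₁.PosSemidef)
    (hγ : γ ∈ couplings (multivariateGaussian m₀ S₀) (multivariateGaussian m₁ S₁)) :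
    jointCovariance γ ∈ blockCovariances S₀ S₁ := by
  have := hγ.1
  have hcoord : ∀ a : Fin d ⊕ Fin d,
      MemLp (fun z : Euc d × Euc d => Sum.elim z.1 z.2 a) 2 γ :=
    Sum.rec (memLp_fst_of_coupling IsGaussian.memLp_two_id hγ).eval_piLp
      (memLp_snd_of_coupling IsGaussian.memLp_two_id hγ).eval_piLp
  refine ⟨posSemidef_covarianceMatrix hcoord, ?_, ?_⟩
  · ext i j
    rw [← covariance_eval_multivariateGaussian (μ := m₀) hS₀ i j, ← hγ.2.1,
      covariance_map_fun (by fun_prop) (by fun_prop) (by fun_prop)]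
    rfl
  · ext i j
    rw [← covariance_eval_multivariateGaussian (μ := m₁) hS₁ i j, ← hγ.2.2,
      covariance_map_fun (by fun_prop) (by fun_prop) (by fun_prop)]
    rfl

lemma integral_inner_of_coupling {μ ν : Measure (Euc d)} (hμ : MemLp id 2 μ) (hν : MemLp id 2 ν)
    (hγ : γ ∈ couplings μ ν) :
    ∫ z, inner ℝ z.1 z.2 ∂γ =
      (jointCovariance γ).toBlocks₁₂.trace + inner ℝ (∫ x, x ∂μ) (∫ y, y ∂ν) := by
  have := hγ.1
  have hfst := (memLp_fst_of_coupling hμ hγ).eval_piLp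
  have hsnd := (memLp_snd_of_coupling hν hγ).eval_piLp
  have hmean {ρ : Measure (Euc d)} {X : Euc d × Euc d → Euc d} (hX : Measurable X)
      (hρ : γ.map X = ρ) (hρ2 : MemLp id 2 ρ) (i : Fin d) :
      (∫ x, x ∂ρ) i = ∫ z, X z i ∂γ := by
    subst hρ
    rw [← integral_map (f := fun x : Euc d => x i) hX.aemeasurable (by fun_prop)]
    exact eval_integral_piLp (f := id) (fun j => (hρ2.eval_piLp j).integrable one_le_two) i
  have hterm (i : Fin d) : ∫ z, z.1 i * z.2 i ∂γ =
      (jointCovariance γ).toBlocks₁₂ i i + (∫ x, x ∂μ) i * (∫ y, y ∂ν) i := by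
    rw [hmean measurable_fst hγ.2.1 hμ, hmean measurable_snd hγ.2.2 hν]
    exact (sub_eq_iff_eq_add.1 (covariance_eq_sub (hfst i) (hsnd i)).symm)
  simp only [PiLp.inner_apply, RCLike.inner_apply, conj_trivial, mul_comm (_ : ℝ)]
  refine (integral_finsetSum _ fun i _ => (hfst i).integrable_mul (hsnd i)).trans ?_
  rw [Matrix.trace, ← Finset.sum_add_distrib]
  exact Finset.sum_congr rfl fun i _ => hterm i

theorem exists_isGaussian_isW2OptimalPlan (m₀ m₁ : Euc d) (hS₀ : S₀.PosSemidef)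
    (hS₁ : S₁.PosSemidef) :
    ∃ γ, IsGaussian γ ∧
      IsW2OptimalPlan (multivariateGaussian m₀ S₀) (multivariateGaussian m₁ S₁) γ := by
  obtain ⟨F, hF, hmax⟩ := (isCompact_blockCovariances S₀ S₁).exists_isMaxOn
    ⟨_, jointCovariance_mem_blockCovariances (m₀ := m₀) (m₁ := m₁) hS₀ hS₁ prod_mem_couplings⟩
    (f := fun F => F.toBlocks₁₂.trace) (by unfold Matrix.toBlocks₁₂; fun_prop)
  have hplan := blockGaussian_mem_couplings (m₀ := m₀) (m₁ := m₁) hF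
  refine ⟨blockGaussian m₀ m₁ F, inferInstance, hplan, fun γ hγ => ?_⟩
  refine (cost_le_cost_iff IsGaussian.memLp_two_id IsGaussian.memLp_two_id hplan hγ).2 ?_
  rw [integral_inner_of_coupling IsGaussian.memLp_two_id IsGaussian.memLp_two_id hplan,
    integral_inner_of_coupling IsGaussian.memLp_two_id IsGaussian.memLp_two_id hγ,
    jointCovariance_blockGaussian hF.1]
  gcongr
  exact hmax (jointCovariance_mem_blockCovariances hS₀ hS₁ hγ)

end GaussianPlans

section GaussianOptimalMaps

variable {d : ℕ} {m₀ m₁ : Euc d} {S₀ S₁ : Matrix (Fin d) (Fin d) ℝ}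

open scoped MatrixOrder in
lemma exists_posSemidef_mul_mul_eq {ι : Type*} [Fintype ι] {S₀ S₁ : Matrix ι ι ℝ}
    (hS₀ : S₀.PosDef) (hS₁ : S₁.PosSemidef) :
    ∃ M : Matrix ι ι ℝ, M.PosSemidef ∧ M * S₀ * M = S₁ := by
  classical
  let R := CFC.sqrt S₀
  have hR : R.PosSemidef := Matrix.nonneg_iff_posSemidef.1 (CFC.sqrt_nonneg S₀)
  have hRR : R * R = S₀ := CFC.sqrt_mul_sqrt_self S₀ hS₀.posSemidef.nonneg
  have hdet : IsUnit R.det := by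
    refine isUnit_of_mul_isUnit_left (y := R.det) ?_
    rw [← Matrix.det_mul, hRR]
    exact hS₀.det_pos.ne'.isUnit
  have hQ : (R * S₁ * R).PosSemidef := by
    simpa only [hR.1.eq] using hS₁.conjTranspose_mul_mul_same R
  let P := CFC.sqrt (R * S₁ * R)
  have hP : P.PosSemidef := Matrix.nonneg_iff_posSemidef.1 (CFC.sqrt_nonneg _)
  have hPP : P * P = R * S₁ * R := CFC.sqrt_mul_sqrt_self _ hQ.nonneg
  refine ⟨R⁻¹ * P * R⁻¹, ?_, ?_⟩
  · simpa only [hR.inv.1.eq] using hP.conjTranspose_mul_mul_same R⁻¹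
  · calc R⁻¹ * P * R⁻¹ * S₀ * (R⁻¹ * P * R⁻¹)
        = R⁻¹ * P * ((R⁻¹ * R) * (R * R⁻¹)) * P * R⁻¹ := by rw [← hRR]; simp only [mul_assoc]
      _ = R⁻¹ * (P * P) * R⁻¹ := by
          rw [Matrix.nonsing_inv_mul R hdet, Matrix.mul_nonsing_inv R hdet]
          simp only [mul_assoc, one_mul]
      _ = (R⁻¹ * R) * S₁ * (R * R⁻¹) := by rw [hPP]; simp only [mul_assoc]
      _ = S₁ := by
          rw [Matrix.nonsing_inv_mul R hdet, Matrix.mul_nonsing_inv R hdet, one_mul, mul_one]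

lemma exists_isPositive_map_multivariateGaussian_eq {ι : Type*} [Fintype ι] [DecidableEq ι]
    {S₀ S₁ : Matrix ι ι ℝ} (m₀ m₁ : EuclideanSpace ℝ ι) (hS₀ : S₀.PosDef) (hS₁ : S₁.PosSemidef) :
    ∃ (A : EuclideanSpace ℝ ι →L[ℝ] EuclideanSpace ℝ ι) (b : EuclideanSpace ℝ ι), A.IsPositive ∧
      (multivariateGaussian m₀ S₀).map (fun x => A x + b) = multivariateGaussian m₁ S₁ := by
  obtain ⟨M, hM, hMS⟩ := exists_posSemidef_mul_mul_eq hS₀ hS₁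
  have hMT : M.transpose = M := by simpa using hM.1.eq
  refine ⟨Matrix.toEuclideanCLM (𝕜 := ℝ) M, m₁ - Matrix.toEuclideanLin M m₀,
    Matrix.isPositive_toEuclideanLin_iff.2 hM, ?_⟩
  have hmap := map_toEuclideanLin_add_multivariateGaussian (m := m₀) hS₀.posSemidef M
    (m₁ - Matrix.toEuclideanLin M m₀)
  rwa [hMT, hMS, add_sub_cancel] at hmap

lemma exists_isW2OptimalMap_iff_multivariateGaussian (m₀ m₁ : Euc d) (hS₀ : S₀.PosDef)
    (hS₁ : S₁.PosSemidef) :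
    ∃ (A : Euc d →L[ℝ] Euc d) (b : Euc d), ∀ {T : Euc d → Euc d}, Measurable T →
      (IsW2OptimalMap (multivariateGaussian m₀ S₀) (multivariateGaussian m₁ S₁) T ↔
        T =ᵐ[multivariateGaussian m₀ S₀] fun x => A x + b) := by
  obtain ⟨A, b, hA, hmap⟩ := exists_isPositive_map_multivariateGaussian_eq m₀ m₁ hS₀ hS₁
  exact ⟨A, b, isW2OptimalMap_iff_of_affine hA IsGaussian.memLp_two_id hmap.symm⟩

theorem exists_isW2OptimalMap_multivariateGaussian (m₀ m₁ : Euc d) (hS₀ : S₀.PosDef)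
    (hS₁ : S₁.PosSemidef) :
    ∃ T, IsW2OptimalMap (multivariateGaussian m₀ S₀) (multivariateGaussian m₁ S₁) T := by
  obtain ⟨A, b, hAb⟩ := exists_isW2OptimalMap_iff_multivariateGaussian m₀ m₁ hS₀ hS₁
  exact ⟨fun x => A x + b, (hAb (by fun_prop)).2 .rfl⟩

theorem ae_eq_of_isW2OptimalMap_multivariateGaussian (hS₀ : S₀.PosDef) (hS₁ : S₁.PosSemidef)
    {T T' : Euc d → Euc d}
    (hT : IsW2OptimalMap (multivariateGaussian m₀ S₀) (multivariateGaussian m₁ S₁) T)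
    (hT' : IsW2OptimalMap (multivariateGaussian m₀ S₀) (multivariateGaussian m₁ S₁) T') :
    T =ᵐ[multivariateGaussian m₀ S₀] T' := by
  obtain ⟨A, b, hAb⟩ := exists_isW2OptimalMap_iff_multivariateGaussian m₀ m₁ hS₀ hS₁
  exact ((hAb hT.1).1 hT).trans ((hAb hT'.1).1 hT').symm

lemma isGaussian_graphPlan_affine {μ : Measure (Euc d)} [IsGaussian μ] (A : Euc d →L[ℝ] Euc d)
    (b : Euc d) : IsGaussian (graphPlan μ fun x => A x + b) := by
  have hgraph : graphPlan μ (fun x => A x + b) =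
      (μ.map ((ContinuousLinearMap.id ℝ (Euc d)).prod A)).map fun z => z + (0, b) := by
    rw [graphPlan, Measure.map_map (by fun_prop) (by fun_prop)]
    congr 1
    funext x
    simp
  rw [hgraph]
  infer_instance

theorem isGaussian_graphPlan_of_isW2OptimalMap (hS₀ : S₀.PosDef) (hS₁ : S₁.PosSemidef)
    {T : Euc d → Euc d}
    (hT : IsW2OptimalMap (multivariateGaussian m₀ S₀) (multivariateGaussian m₁ S₁) T) :
    IsGaussian (graphPlan (multivariateGaussian m₀ S₀) T) := by
  obtain ⟨A, b, hAb⟩ := exists_isW2OptimalMap_iff_multivariateGaussian m₀ m₁ hS₀ hS₁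
  have hgraph : graphPlan (multivariateGaussian m₀ S₀) T =
      graphPlan (multivariateGaussian m₀ S₀) fun x => A x + b :=
    Measure.map_congr (Filter.EventuallyEq.rfl.prodMk ((hAb hT.1).1 hT))
  rw [hgraph]
  exact isGaussian_graphPlan_affine A b

end GaussianOptimalMaps

section DiscreteCouplings

variable {K L : ℕ} {p : Fin K → ℝ≥0} {q : Fin L → ℝ≥0} {w : Matrix (Fin K) (Fin L) ℝ≥0}

lemma sum_sum_of_mem_discreteCouplings (hw : w ∈ discreteCouplings p q) :
    ∑ k, ∑ l, w k l = ∑ k, p k :=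
  Finset.sum_congr rfl fun k _ => hw.1 k

lemma apply_le_left_of_mem_discreteCouplings (hw : w ∈ discreteCouplings p q) (k : Fin K)
    (l : Fin L) : w k l ≤ p k :=
  hw.1 k ▸ Finset.single_le_sum_of_canonicallyOrdered (f := fun l => w k l) (Finset.mem_univ l)

lemma apply_le_right_of_mem_discreteCouplings (hw : w ∈ discreteCouplings p q) (k : Fin K)
    (l : Fin L) : w k l ≤ q l :=
  hw.2 l ▸ Finset.single_le_sum_of_canonicallyOrdered (f := fun k => w k l) (Finset.mem_univ k)

lemma nonempty_discreteCouplings (h : ∑ k, p k = ∑ l, q l) : (discreteCouplings p q).Nonempty := by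
  refine ⟨fun k l => p k * q l / ∑ k, p k, fun k => ?_, fun l => ?_⟩
  · rw [← Finset.sum_div, ← Finset.mul_sum, ← h]
    refine mul_div_cancel_of_imp fun hzero => ?_
    exact Finset.sum_eq_zero_iff.1 hzero k (Finset.mem_univ k)
  · rw [← Finset.sum_div, ← Finset.sum_mul, mul_comm]
    refine mul_div_cancel_of_imp fun hzero => ?_
    exact Finset.sum_eq_zero_iff.1 (h ▸ hzero) l (Finset.mem_univ l)

lemma sum_mem_discreteCouplings {J : Type*} {s : Finset J} {a : J → Fin K → ℝ≥0}
    {b : J → Fin L → ℝ≥0} {t : J → Matrix (Fin K) (Fin L) ℝ≥0}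
    (ht : ∀ j, t j ∈ discreteCouplings (a j) (b j)) :
    ∑ j ∈ s, t j ∈ discreteCouplings (∑ j ∈ s, a j) (∑ j ∈ s, b j) := by
  refine ⟨fun k => ?_, fun l => ?_⟩
  · simp only [Matrix.sum_apply, Finset.sum_apply, ← (ht _).1 k]
    exact Finset.sum_comm
  · simp only [Matrix.sum_apply, Finset.sum_apply, ← (ht _).2 l]
    exact Finset.sum_comm

lemma exists_discreteCouplings_gluing {N : ℕ} {r : Fin N → ℝ≥0} {a : Matrix (Fin N) (Fin K) ℝ≥0}
    {b : Matrix (Fin N) (Fin L) ℝ≥0} (ha : a ∈ discreteCouplings r p)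
    (hb : b ∈ discreteCouplings r q) :
    ∃ t : Fin N → Matrix (Fin K) (Fin L) ℝ≥0, ∑ j, t j ∈ discreteCouplings p q ∧
      (∀ j, ∑ k, ∑ l, t j k l = r j) ∧ ∀ j k l, t j k l ≠ 0 → a j k ≠ 0 ∧ b j l ≠ 0 := by
  have hrow (j : Fin N) : (discreteCouplings (a j) (b j)).Nonempty :=
    nonempty_discreteCouplings ((ha.1 j).trans (hb.1 j).symm)
  choose t ht using hrow
  have hp : ∑ j, a j = p := funext fun k => (Finset.sum_apply k _ a).trans (ha.2 k)
  have hq : ∑ j, b j = q := funext fun l => (Finset.sum_apply l _ b).trans (hb.2 l)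
  refine ⟨t, hp ▸ hq ▸ sum_mem_discreteCouplings ht,
    fun j => (sum_sum_of_mem_discreteCouplings (ht j)).trans (ha.1 j), fun j k l hne => ?_⟩
  have hpos := pos_of_ne_zero hne
  exact ⟨(hpos.trans_le (apply_le_left_of_mem_discreteCouplings (ht j) k l)).ne',
    (hpos.trans_le (apply_le_right_of_mem_discreteCouplings (ht j) k l)).ne'⟩

lemma isCompact_discreteCouplings (p : Fin K → ℝ≥0) (q : Fin L → ℝ≥0) :
    IsCompact (discreteCouplings p q) := by
  have hbox : IsCompact (Set.univ.pi fun k => Set.univ.pi fun _ => Set.Icc 0 (p k) :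
      Set (Matrix (Fin K) (Fin L) ℝ≥0)) :=
    isCompact_univ_pi fun _ => isCompact_univ_pi fun _ => isCompact_Icc
  have hclosed : IsClosed (discreteCouplings p q) := by
    simp only [discreteCouplings, Set.ofPred_and, Set.ofPred_forall]
    refine IsClosed.inter (isClosed_iInter fun k => ?_) (isClosed_iInter fun l => ?_) <;>
      exact isClosed_eq (by fun_prop) (by fun_prop)
  exact hbox.of_isClosed_subset hclosed fun w hw k _ l _ =>
    ⟨zero_le, apply_le_left_of_mem_discreteCouplings hw k l⟩

open scoped Classical in
lemma exists_discreteCoupling_of_sum_single_eq {X : Type*} {α : Fin K → X} {β : Fin L → X}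
    (h : ∑ k, Finsupp.single (α k) (p k) = ∑ l, Finsupp.single (β l) (q l)) :
    ∃ w ∈ discreteCouplings p q, ∀ k l, w k l ≠ 0 → α k = β l := by
  let mass : X → ℝ≥0 := fun x => ∑ k with α k = x, p k
  have hmass (x : X) : mass x = ∑ l with β l = x, q l := by
    have hx := DFunLike.congr_fun h x
    simpa only [Finsupp.coe_finsetSum, Finset.sum_apply, Finsupp.single_apply,
      ← Finset.sum_filter] using hx
  have hp (k : Fin K) (hzero : mass (α k) = 0) : p k = 0 :=
    Finset.sum_eq_zero_iff.1 hzero k (by simp)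
  have hq (l : Fin L) (hzero : mass (β l) = 0) : q l = 0 :=
    Finset.sum_eq_zero_iff.1 (hmass _ ▸ hzero) l (by simp)
  refine ⟨fun k l => if α k = β l then p k * q l / mass (α k) else 0,
    ⟨fun k => ?_, fun l => ?_⟩, fun k l => ?_⟩
  · simp only [eq_comm (a := α k)]
    rw [← Finset.sum_filter, ← Finset.sum_div, ← Finset.mul_sum, ← hmass]
    exact mul_div_cancel_of_imp (hp k)
  · rw [← Finset.sum_filter, Finset.sum_congr rfl
      (g := fun k => q l * p k / mass (β l)) fun k hk => by
        rw [(Finset.mem_filter.1 hk).2, mul_comm], ← Finset.sum_div, ← Finset.mul_sum]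
    exact mul_div_cancel_of_imp (hq l)
  · exact fun hkl => by_contra fun hne => hkl (if_neg hne)

lemma exists_discreteCoupling_of_linearIndepOn {M : Type*} [AddCommMonoid M] [Module ℝ≥0 M]
    {s : Set M} (hs : LinearIndepOn ℝ≥0 id s) {α : Fin K → M} {β : Fin L → M}
    (hα : ∀ k, α k ∈ s) (hβ : ∀ l, β l ∈ s) (h : ∑ k, p k • α k = ∑ l, q l • β l) :
    ∃ w ∈ discreteCouplings p q, ∀ k l, w k l ≠ 0 → α k = β l := by
  refine exists_discreteCoupling_of_sum_single_eq (linearIndepOn_iffₛ.1 hs _ ?_ _ ?_ ?_)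
  · exact Submodule.sum_mem _ fun k _ => Finsupp.single_mem_supported _ _ (hα k)
  · exact Submodule.sum_mem _ fun l _ => Finsupp.single_mem_supported _ _ (hβ l)
  · simpa only [map_sum, Finsupp.linearCombination_single, id_eq] using h

end DiscreteCouplings

section DiscreteCost

variable {d K L : ℕ} {μ : Fin K → Measure (Euc d)} {ν : Fin L → Measure (Euc d)}

lemma continuous_discreteCost (hW : ∀ k l, W2sq (μ k) (ν l) ≠ ∞) :
    Continuous (discreteCost μ ν) := by
  refine continuous_finsetSum _ fun k _ => continuous_finsetSum _ fun l _ => ?_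
  exact (ENNReal.continuous_mul_const (hW k l)).comp
    (ENNReal.continuous_coe.comp (by fun_prop : Continuous fun w : Matrix _ _ ℝ≥0 => w k l))

lemma discreteCost_ne_top (hW : ∀ k l, W2sq (μ k) (ν l) ≠ ∞) (w : Matrix (Fin K) (Fin L) ℝ≥0) :
    discreteCost μ ν w ≠ ∞ :=
  ENNReal.sum_ne_top.2 fun k _ => ENNReal.sum_ne_top.2 fun l _ =>
    ENNReal.mul_ne_top ENNReal.coe_ne_top (hW k l)

lemma discreteCost_sum {J : Type*} (s : Finset J) (t : J → Matrix (Fin K) (Fin L) ℝ≥0) :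
    discreteCost μ ν (∑ j ∈ s, t j) = ∑ j ∈ s, discreteCost μ ν (t j) := by
  simp only [discreteCost, Matrix.sum_apply, ENNReal.ofNNReal_finsetSum, Finset.sum_mul]
  rw [Finset.sum_comm (s := s)]
  exact Finset.sum_congr rfl fun k _ => Finset.sum_comm

lemma discreteCost_eq_mul_W2sq {μ' ν' : Measure (Euc d)} {w : Matrix (Fin K) (Fin L) ℝ≥0}
    (hw : ∀ k l, w k l ≠ 0 → μ k = μ' ∧ ν l = ν') :
    discreteCost μ ν w = (∑ k, ∑ l, w k l : ℝ≥0) * W2sq μ' ν' := by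
  simp only [discreteCost, ENNReal.ofNNReal_finsetSum, Finset.sum_mul]
  refine Finset.sum_congr rfl fun k _ => Finset.sum_congr rfl fun l _ => ?_
  by_cases hkl : w k l = 0
  · simp [hkl]
  · rw [(hw k l hkl).1, (hw k l hkl).2]

end DiscreteCost

section Mixtures

variable {d K L : ℕ} {p : Fin K → ℝ≥0} {q : Fin L → ℝ≥0} {μ : Fin K → Measure (Euc d)}
  {ν : Fin L → Measure (Euc d)}

lemma cost_sum_smul {ι : Type*} (s : Finset ι) (r : ι → ℝ≥0) (γ : ι → Measure (Euc d × Euc d)) :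
    cost (∑ i ∈ s, r i • γ i) = ∑ i ∈ s, (r i : ℝ≥0∞) * cost (γ i) := by
  simp only [cost, lintegral_finsetSum_measure, lintegral_smul_measure, ENNReal.smul_def,
    smul_eq_mul]

lemma isGaussianMixture_sum_smul {E ι : Type*} [TopologicalSpace E] [AddCommMonoid E] [Module ℝ E]
    [MeasurableSpace E] [Fintype ι] {r : ι → ℝ≥0} {γ : ι → Measure E} (hr : ∑ i, r i = 1)
    (hγ : ∀ i, IsGaussian (γ i)) : IsGaussianMixture (∑ i, r i • γ i) := by
  let e := (Fintype.equivFin ι).symm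
  exact ⟨Fintype.card ι, r ∘ e, γ ∘ e, (e.sum_comp r).trans hr, fun k => hγ (e k),
    (e.sum_comp fun i => r i • γ i).symm⟩

lemma sum_smul_mem_couplings {w : Matrix (Fin K) (Fin L) ℝ≥0}
    {γ : Fin K → Fin L → Measure (Euc d × Euc d)} (hp : ∑ k, p k = 1)
    (hw : w ∈ discreteCouplings p q) (hγ : ∀ k l, γ k l ∈ couplings (μ k) (ν l)) :
    ∑ k, ∑ l, w k l • γ k l ∈ couplings (∑ k, p k • μ k) (∑ l, q l • ν l) := by
  have hfst (k : Fin K) (l : Fin L) := (hγ k l).2.1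
  have hsnd (k : Fin K) (l : Fin L) := (hγ k l).2.2
  have hone (k : Fin K) (l : Fin L) : γ k l Set.univ = 1 := (hγ k l).1.measure_univ
  refine ⟨⟨?_⟩, ?_, ?_⟩
  · simp only [Measure.coe_finsetSum, Finset.sum_apply, Measure.smul_apply, hone,
      ENNReal.smul_def, smul_eq_mul, mul_one]
    exact_mod_cast (sum_sum_of_mem_discreteCouplings hw).trans hp
  · simp only [Measure.map_finset_sum measurable_fst.aemeasurable, Measure.map_smul, hfst,
      ← Finset.sum_smul, hw.1]
  · rw [Finset.sum_comm]
    simp only [Measure.map_finset_sum measurable_snd.aemeasurable, Measure.map_smul, hsnd,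
      ← Finset.sum_smul, hw.2]

lemma sum_smul_mem_gmmCouplings {w : Matrix (Fin K) (Fin L) ℝ≥0}
    {γ : Fin K → Fin L → Measure (Euc d × Euc d)} (hp : ∑ k, p k = 1)
    (hw : w ∈ discreteCouplings p q) (hγ : ∀ k l, γ k l ∈ couplings (μ k) (ν l))
    (hG : ∀ k l, IsGaussian (γ k l)) :
    ∑ k, ∑ l, w k l • γ k l ∈ gmmCouplings (∑ k, p k • μ k) (∑ l, q l • ν l) := by
  refine ⟨sum_smul_mem_couplings hp hw hγ, ?_⟩
  have hsum : ∑ x : Fin K × Fin L, w x.1 x.2 = 1 := by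
    rw [Fintype.sum_prod_type, sum_sum_of_mem_discreteCouplings hw, hp]
  rw [← Fintype.sum_prod_type' fun k l => w k l • γ k l]
  exact isGaussianMixture_sum_smul hsum fun x => hG x.1 x.2

lemma cost_sum_smul_eq_discreteCost (w : Matrix (Fin K) (Fin L) ℝ≥0)
    {γ : Fin K → Fin L → Measure (Euc d × Euc d)}
    (hγ : ∀ k l, IsW2OptimalPlan (μ k) (ν l) (γ k l)) :
    cost (∑ k, ∑ l, w k l • γ k l) = discreteCost μ ν w := by
  rw [← Fintype.sum_prod_type' fun k l => w k l • γ k l, cost_sum_smul, Fintype.sum_prod_type]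
  simp only [cost_eq_W2sq (hγ _ _), discreteCost]

lemma W2sq_map_fst_map_snd_le_cost (γ : Measure (Euc d × Euc d)) [IsProbabilityMeasure γ] :
    W2sq (γ.map Prod.fst) (γ.map Prod.snd) ≤ cost γ :=
  iInf₂_le γ ⟨inferInstance, rfl, rfl⟩

theorem exists_discreteCost_le [∀ k, IsGaussian (μ k)] [∀ l, IsGaussian (ν l)]
    {γ : Measure (Euc d × Euc d)}
    (hγ : γ ∈ gmmCouplings (∑ k, p k • μ k) (∑ l, q l • ν l)) :
    ∃ w ∈ discreteCouplings p q, discreteCost μ ν w ≤ cost γ := by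
  obtain ⟨⟨-, hfst, hsnd⟩, N, r, κ, -, hκ, rfl⟩ := hγ
  simp only [Measure.map_finset_sum measurable_fst.aemeasurable, Measure.map_smul] at hfst
  simp only [Measure.map_finset_sum measurable_snd.aemeasurable, Measure.map_smul] at hsnd
  have hκfst (j : Fin N) : IsGaussian ((κ j).map Prod.fst) :=
    isGaussian_map (ContinuousLinearMap.fst ℝ (Euc d) (Euc d))
  have hκsnd (j : Fin N) : IsGaussian ((κ j).map Prod.snd) :=
    isGaussian_map (ContinuousLinearMap.snd ℝ (Euc d) (Euc d))
  obtain ⟨a, ha, haμ⟩ :=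
    exists_discreteCoupling_of_linearIndepOn linearIndepOn_isGaussian hκfst ‹_› hfst
  obtain ⟨b, hb, hbν⟩ :=
    exists_discreteCoupling_of_linearIndepOn linearIndepOn_isGaussian hκsnd ‹_› hsnd
  obtain ⟨t, htsum, htr, hsupport⟩ := exists_discreteCouplings_gluing ha hb
  refine ⟨∑ j, t j, htsum, ?_⟩
  calc discreteCost μ ν (∑ j, t j)
      = ∑ j, discreteCost μ ν (t j) := discreteCost_sum _ _
    _ = ∑ j, (r j : ℝ≥0∞) * W2sq ((κ j).map Prod.fst) ((κ j).map Prod.snd) :=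
        Finset.sum_congr rfl fun j _ => by
          rw [discreteCost_eq_mul_W2sq fun k l hkl => ?_, htr]
          exact ⟨(haμ j k (hsupport j k l hkl).1).symm, (hbν j l (hsupport j k l hkl).2).symm⟩
    _ ≤ ∑ j, (r j : ℝ≥0∞) * cost (κ j) :=
        Finset.sum_le_sum fun j _ => mul_le_mul_right (W2sq_map_fst_map_snd_le_cost (κ j)) _
    _ = cost (∑ j, r j • κ j) := (cost_sum_smul _ _ _).symm

end Mixtures

section Main

variable {d K L : ℕ} {p : Fin K → ℝ≥0} {q : Fin L → ℝ≥0} {μ : Fin K → Measure (Euc d)}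
  {ν : Fin L → Measure (Euc d)} {w : Matrix (Fin K) (Fin L) ℝ≥0}
  {γ : Fin K → Fin L → Measure (Euc d × Euc d)}

theorem isMW2OptimalPlan_sum_smul [∀ k, IsGaussian (μ k)] [∀ l, IsGaussian (ν l)]
    (hp : ∑ k, p k = 1) (hw : w ∈ discreteCouplings p q)
    (hmin : IsMinOn (discreteCost μ ν) (discreteCouplings p q) w)
    (hG : ∀ k l, IsGaussian (γ k l)) (hγ : ∀ k l, IsW2OptimalPlan (μ k) (ν l) (γ k l)) :
    IsMW2OptimalPlan (∑ k, p k • μ k) (∑ l, q l • ν l) (∑ k, ∑ l, w k l • γ k l) := by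
  refine ⟨sum_smul_mem_gmmCouplings hp hw (fun k l => (hγ k l).1) hG, fun γ' hγ' => ?_⟩
  obtain ⟨w', hw', hle⟩ := exists_discreteCost_le hγ'
  exact (cost_sum_smul_eq_discreteCost w hγ).trans_le ((hmin hw').trans hle)

lemma cost_eq_MW2sq {μ ν : Measure (Euc d)} {γ : Measure (Euc d × Euc d)}
    (h : IsMW2OptimalPlan μ ν γ) : cost γ = MW2sq μ ν :=
  le_antisymm (le_iInf₂ fun _ hγ' => h.2 hγ') (iInf₂_le γ h.1)

lemma exists_isMinOn_discreteCost (hpq : ∑ k, p k = ∑ l, q l)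
    (hW : ∀ k l, W2sq (μ k) (ν l) ≠ ∞) :
    ∃ w ∈ discreteCouplings p q, IsMinOn (discreteCost μ ν) (discreteCouplings p q) w :=
  (isCompact_discreteCouplings p q).exists_isMinOn (nonempty_discreteCouplings hpq)
    (continuous_discreteCost hW).continuousOn

theorem isLeast_MW2sq [∀ k, IsGaussian (μ k)] [∀ l, IsGaussian (ν l)] (hp : ∑ k, p k = 1)
    (hq : ∑ l, q l = 1) (hG : ∀ k l, IsGaussian (γ k l))
    (hγ : ∀ k l, IsW2OptimalPlan (μ k) (ν l) (γ k l)) :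
    IsLeast (discreteCost μ ν '' discreteCouplings p q)
      (MW2sq (∑ k, p k • μ k) (∑ l, q l • ν l)) := by
  obtain ⟨w, hw, hmin⟩ := exists_isMinOn_discreteCost (hp.trans hq.symm) fun k l =>
    W2sq_ne_top (μ := μ k) (ν := ν l) IsGaussian.memLp_two_id IsGaussian.memLp_two_id
  have hval : discreteCost μ ν w = MW2sq (∑ k, p k • μ k) (∑ l, q l • ν l) := by
    rw [← cost_sum_smul_eq_discreteCost w hγ]
    exact cost_eq_MW2sq (isMW2OptimalPlan_sum_smul hp hw hmin hG hγ)
  refine ⟨⟨w, hw, hval⟩, ?_⟩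
  rintro _ ⟨w', hw', rfl⟩
  exact hval.symm.trans_le (hmin hw')

end Main

end GMMTransport

open GMMTransport in
theorem mainTheorem1 {d K₀ K₁ : ℕ}
    (p₀ : Fin K₀ → ℝ≥0) (p₁ : Fin K₁ → ℝ≥0) (hp₀ : ∑ k, p₀ k = 1) (hp₁ : ∑ l, p₁ l = 1)
    (m₀ : Fin K₀ → EuclideanSpace ℝ (Fin d)) (m₁ : Fin K₁ → EuclideanSpace ℝ (Fin d))
    (S₀ : Fin K₀ → Matrix (Fin d) (Fin d) ℝ) (S₁ : Fin K₁ → Matrix (Fin d) (Fin d) ℝ)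
    (hS₀ : ∀ k, (S₀ k).PosSemidef) (hS₁ : ∀ l, (S₁ l).PosSemidef)
    (c₀ : Fin K₀ → Measure (EuclideanSpace ℝ (Fin d)))
    (c₁ : Fin K₁ → Measure (EuclideanSpace ℝ (Fin d)))
    (hc₀ : ∀ k, c₀ k = multivariateGaussian (m₀ k) (S₀ k))
    (hc₁ : ∀ l, c₁ l = multivariateGaussian (m₁ l) (S₁ l))
    (μ₀ μ₁ : Measure (EuclideanSpace ℝ (Fin d)))
    (hμ₀ : μ₀ = ∑ k, p₀ k • c₀ k) (hμ₁ : μ₁ = ∑ l, p₁ l • c₁ l) :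
    -- the discrete formula, with a minimum that is attained
    MW2sq μ₀ μ₁ ≠ ∞ ∧
    IsLeast (discreteCost c₀ c₁ '' discreteCouplings p₀ p₁) (MW2sq μ₀ μ₁) ∧
    -- Gaussian optimal plans between components exist; so do optimal maps, uniquely almost
    -- everywhere, when the source covariance is nonsingular
    (∀ k l, ∃ γ, IsGaussian γ ∧ IsW2OptimalPlan (c₀ k) (c₁ l) γ) ∧
    (∀ k l, (S₀ k).PosDef →
      (∃ T, IsW2OptimalMap (c₀ k) (c₁ l) T) ∧
      ∀ T T', IsW2OptimalMap (c₀ k) (c₁ l) T → IsW2OptimalMap (c₀ k) (c₁ l) T' →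
        T =ᵐ[c₀ k] T') ∧
    -- every discrete minimizer yields optimal plans for `MW₂`
    ∀ w ∈ discreteCouplings p₀ p₁, IsMinOn (discreteCost c₀ c₁) (discreteCouplings p₀ p₁) w →
      (∀ γ : Fin K₀ → Fin K₁ →
          Measure (EuclideanSpace ℝ (Fin d) × EuclideanSpace ℝ (Fin d)),
        (∀ k l, IsGaussian (γ k l) ∧ IsW2OptimalPlan (c₀ k) (c₁ l) (γ k l)) →
        IsMW2OptimalPlan μ₀ μ₁ (∑ k, ∑ l, w k l • γ k l)) ∧
      ((∀ k, (S₀ k).PosDef) →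
        ∀ T : Fin K₀ → Fin K₁ → EuclideanSpace ℝ (Fin d) → EuclideanSpace ℝ (Fin d),
        (∀ k l, IsW2OptimalMap (c₀ k) (c₁ l) (T k l)) →
        IsMW2OptimalPlan μ₀ μ₁ (∑ k, ∑ l, w k l • graphPlan (c₀ k) (T k l))) := by
  have hG₀ (k : Fin K₀) : IsGaussian (c₀ k) := hc₀ k ▸ inferInstance
  have hG₁ (l : Fin K₁) : IsGaussian (c₁ l) := hc₁ l ▸ inferInstance
  have hW (k : Fin K₀) (l : Fin K₁) : W2sq (c₀ k) (c₁ l) ≠ ∞ :=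
    W2sq_ne_top IsGaussian.memLp_two_id IsGaussian.memLp_two_id
  have hplans (k : Fin K₀) (l : Fin K₁) : ∃ γ, IsGaussian γ ∧ IsW2OptimalPlan (c₀ k) (c₁ l) γ := by
    rw [hc₀, hc₁]
    exact exists_isGaussian_isW2OptimalPlan (m₀ k) (m₁ l) (hS₀ k) (hS₁ l)
  subst hμ₀ hμ₁
  have hleast : IsLeast (discreteCost c₀ c₁ '' discreteCouplings p₀ p₁)
      (MW2sq (∑ k, p₀ k • c₀ k) (∑ l, p₁ l • c₁ l)) := by
    choose γ hG hγ using hplans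
    exact isLeast_MW2sq hp₀ hp₁ hG hγ
  refine ⟨?_, hleast, hplans, fun k l hS => ?_, fun w hw hmin => ⟨fun γ hγ => ?_, ?_⟩⟩
  · obtain ⟨w, -, hval⟩ := hleast.1
    exact hval ▸ discreteCost_ne_top hW w
  · rw [hc₀, hc₁]
    exact ⟨exists_isW2OptimalMap_multivariateGaussian _ _ hS (hS₁ l), fun T T' hT hT' =>
      ae_eq_of_isW2OptimalMap_multivariateGaussian hS (hS₁ l) hT hT'⟩
  · exact isMW2OptimalPlan_sum_smul hp₀ hw hmin (fun k l => (hγ k l).1) fun k l => (hγ k l).2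
  · intro hpd T hT
    refine isMW2OptimalPlan_sum_smul hp₀ hw hmin (fun k l => ?_) fun k l => (hT k l).2
    simp only [hc₀, hc₁] at hT ⊢
    exact isGaussian_graphPlan_of_isW2OptimalMap (hpd k) (hS₁ l) (hT k l)
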